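/- For a real-valued random variable $X$ with density $f$ with respect to Lebesgue measure, let $$h(X)=-\int_{\mathbb{R}} f(x)\log f(x)\,dx$$ denote its differential entropy (natural logarithm, $0\log 0=0$); we say that $X$ has finite differential entropy if $X$ has a density $f$ and $f\log f$ is Lebesgue integrable. **Theorem.** For every $M\in\mathbb{R}$ there exist i.i.d. real-valued random variables $X, Y$ with finite differential entropy such that $X+Y$ and $X-Y$ also have finite differential entropy and $$h(X+Y)-h(X-Y)=M.$$ -/

import Mathlib

open MeasureTheory ProbabilityTheory

noncomputable section

/-- The (real-valued) probability density function `f` of a real random variable `X` with respect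
to Lebesgue measure; meaningful when `X` has a density, i.e. under `HasPDF X P volume`. -/
def realDensity {Ω : Type*} [MeasurableSpace Ω] (P : Measure Ω) (X : Ω → ℝ) (x : ℝ) : ℝ :=
  (pdf X P volume x).toReal

/-- The differential entropy `h(X) = -∫ f(x) log f(x) dx` of a real random variable `X` with
density `f` (with the usual convention `0 log 0 = 0`). -/
def differentialEntropy {Ω : Type*} [MeasurableSpace Ω] (P : Measure Ω) (X : Ω → ℝ) : ℝ :=
  -∫ x : ℝ, realDensity P X x * Real.log (realDensity P X x)

/-- `X` has finite differential entropy: it has a density `f` with respect to Lebesgue measure,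
and `f log f` is Lebesgue integrable. -/
def HasFiniteDifferentialEntropy {Ω : Type*} [MeasurableSpace Ω] (P : Measure Ω) (X : Ω → ℝ) :
    Prop :=
  HasPDF X P volume ∧
    Integrable (fun x : ℝ => realDensity P X x * Real.log (realDensity P X x)) volume

end

/-! The problem reduces to integers. Let `K` have a finitely supported law and let `U` be an
independent uniform variable on `(-1/2, 1/2)`; put `X = 2K + U` and let `Y` be an independent copy.
As `U` is symmetric, `X + Y` and `X - Y` are `2(K ± K')` plus a variable with the same tent density,
supported in `(-1, 1)`. The translates by even integers do not overlap, so each entropy is the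
discrete entropy of `K ± K'` plus that of the tent, and the tent's part cancels
(`integral_negMulLog_superpose`).

Laws on the integers are encoded as Laurent polynomials `p` of mass one: the sum has law `p * p`,
the difference `p * invert p`. All real gaps occur because one explicit law has positive gap and
another negative gap, gaps add (`exists_entropyGap_add`), and the gap varies continuously along
mixtures (`exists_entropyGap_eq`). -/

open LaurentPolynomial
open scoped NNReal ENNReal Pointwise

namespace LaurentPolynomial

/-! ### Laws on the integers as Laurent polynomials -/

/-- The sum of the coefficients of a Laurent polynomial. -/
noncomputable def mass : ℝ≥0[T;T⁻¹] →+* ℝ≥0 := eval₂ (RingHom.id ℝ≥0) 1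

/-- The Shannon entropy functional of the family of coefficients. -/
noncomputable def shannon (q : ℝ≥0[T;T⁻¹]) : ℝ :=
  q.coeff.sum fun _ a => Real.negMulLog a

/-- The entropy of the sum minus the entropy of the difference of two independent integers
distributed according to the coefficients of `p`. -/
noncomputable def entropyGap (p : ℝ≥0[T;T⁻¹]) : ℝ :=
  shannon (p * p) - shannon (p * invert p)

/-- The substitution `T ↦ T ^ L`. -/
noncomputable def dilate (L : ℤ) : ℝ≥0[T;T⁻¹] →+* ℝ≥0[T;T⁻¹] :=
  AddMonoidAlgebra.mapDomainRingHom ℝ≥0 (AddMonoidHom.mulLeft L)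

lemma mass_single (n : ℤ) (a : ℝ≥0) : mass (.single n a) = a := by
  rw [single_eq_C_mul_T, mass, eval₂_C_mul_T]; simp

lemma mass_eq_sum (q : ℝ≥0[T;T⁻¹]) : mass q = q.coeff.sum fun _ a => a := by
  conv_lhs => rw [← AddMonoidAlgebra.sum_coeff_single q, map_finsuppSum]
  exact Finset.sum_congr rfl fun k _ => mass_single _ _

lemma mass_C (a : ℝ≥0) : mass (C a) = a := mass_single 0 a

lemma mass_T (n : ℤ) : mass (T n) = 1 := mass_single n 1

lemma mass_invert (q : ℝ≥0[T;T⁻¹]) : mass (invert q) = mass q := by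
  induction q using LaurentPolynomial.induction_on' with
  | add p q hp hq => simp [hp, hq]
  | C_mul_T n a => simp [mass_C, mass_T]

lemma dilate_single (L n : ℤ) (a : ℝ≥0) : dilate L (.single n a) = .single (L * n) a :=
  AddMonoidAlgebra.mapDomain_single

lemma mass_dilate (L : ℤ) (q : ℝ≥0[T;T⁻¹]) : mass (dilate L q) = mass q := by
  induction q using LaurentPolynomial.induction_on' with
  | add p q hp hq => simp [hp, hq]
  | C_mul_T n a => rw [← single_eq_C_mul_T, dilate_single, mass_single, mass_single]

lemma invert_single (n : ℤ) (a : ℝ≥0) : invert (.single n a : ℝ≥0[T;T⁻¹]) = .single (-n) a := by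
  rw [single_eq_C_mul_T, single_eq_C_mul_T]; simp

lemma invert_dilate (L : ℤ) (q : ℝ≥0[T;T⁻¹]) : invert (dilate L q) = dilate L (invert q) := by
  induction q using LaurentPolynomial.induction_on' with
  | add p q hp hq => simp [hp, hq]
  | C_mul_T n a =>
    rw [← single_eq_C_mul_T, dilate_single, invert_single, invert_single, dilate_single, mul_neg]

lemma shannon_eq_sum {q : ℝ≥0[T;T⁻¹]} {s : Finset ℤ} (h : q.coeff.support ⊆ s) :
    shannon q = ∑ k ∈ s, Real.negMulLog (q.coeff k) :=
  Finsupp.sum_of_support_subset _ h _ (by simp)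

lemma shannon_dilate {L : ℤ} (hL : L ≠ 0) (q : ℝ≥0[T;T⁻¹]) : shannon (dilate L q) = shannon q := by
  have : (dilate L q).coeff = Finsupp.mapDomain (fun n => L * n) q.coeff := rfl
  rw [shannon, this, Finsupp.sum_mapDomain_index_inj (mul_right_injective₀ hL), shannon]

lemma support_dilate (L : ℤ) (q : ℝ≥0[T;T⁻¹]) {k : ℤ} (hk : k ∈ (dilate L q).coeff.support) :
    L ∣ k := by
  have : (dilate L q).coeff = Finsupp.mapDomain (fun n => L * n) q.coeff := rfl
  rw [this] at hk
  obtain ⟨n, -, rfl⟩ := Finset.mem_image.1 (Finsupp.mapDomain_support hk)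
  exact dvd_mul_right _ _

/-- When all sums of exponents are distinct, the coefficients of the product are the products `a *
b`, and `negMulLog (a * b) = b * negMulLog a + a * negMulLog b`. The masses appear because nothing
is normalised. -/
lemma shannon_mul {x y : ℝ≥0[T;T⁻¹]}
    (h : ∀ i ∈ x.coeff.support, ∀ j ∈ y.coeff.support, UniqueAdd x.coeff.support y.coeff.support i j) :
    shannon (x * y) = mass y * shannon x + mass x * shannon y := by
  have hinj : Set.InjOn (fun ij : ℤ × ℤ => ij.1 + ij.2)
      (x.coeff.support ×ˢ y.coeff.support : Finset (ℤ × ℤ)) := by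
    rintro ⟨i, j⟩ hij ⟨k, l⟩ hkl e
    simp only [Finset.coe_product, Set.mem_prod, Finset.mem_coe] at hij hkl
    have := h k hkl.1 l hkl.2 hij.1 hij.2 e
    exact Prod.ext this.1 this.2
  have hsupp : (x * y).coeff.support ⊆
      (x.coeff.support ×ˢ y.coeff.support).image (fun ij : ℤ × ℤ => ij.1 + ij.2) := by
    refine (AddMonoidAlgebra.support_coeff_mul_subset x y).trans ?_
    intro k hk
    obtain ⟨i, hi, j, hj, rfl⟩ := Finset.mem_add.1 hk
    exact Finset.mem_image.2 ⟨(i, j), Finset.mem_product.2 ⟨hi, hj⟩, rfl⟩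
  rw [shannon_eq_sum hsupp, Finset.sum_image hinj, Finset.sum_product, mass_eq_sum, mass_eq_sum,
    shannon, shannon, Finsupp.sum, Finsupp.sum, Finsupp.sum, Finsupp.sum]
  push_cast
  rw [Finset.sum_mul_sum, Finset.sum_mul_sum, Finset.sum_comm (s := y.coeff.support),
    ← Finset.sum_add_distrib]
  refine Finset.sum_congr rfl fun i hi => ?_
  rw [← Finset.sum_add_distrib]
  refine Finset.sum_congr rfl fun j hj => ?_
  rw [AddMonoidAlgebra.coeff_mul_add_of_uniqueAdd (h i hi j hj)]
  push_cast
  rw [Real.negMulLog_mul]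

lemma shannon_C_mul (c : ℝ≥0) (q : ℝ≥0[T;T⁻¹]) :
    shannon (C c * q) = mass q * Real.negMulLog c + c * shannon q := by
  rw [shannon_mul, mass_C, ← single_eq_C, shannon, AddMonoidAlgebra.coeff_single,
    Finsupp.sum_single_index (by simp)]
  intro i hi j hj k l hk hl e
  have key : ∀ m ∈ (C c : ℝ≥0[T;T⁻¹]).coeff.support, m = 0 := fun m hm => by
    by_contra h0
    simp [h0] at hm
  have := key i hi
  have := key k hk
  omega

/-- The inhomogeneous terms cancel since `p * p` and `p * invert p` have equal mass. The sign of a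
gap can therefore be tested on integer coefficients. -/
lemma entropyGap_C_mul (c : ℝ≥0) (p : ℝ≥0[T;T⁻¹]) :
    entropyGap (C c * p) = c ^ 2 * entropyGap p := by
  have h1 : C c * p * (C c * p) = C (c ^ 2) * (p * p) := by rw [map_pow]; ring
  have h2 : C c * p * invert (C c * p) = C (c ^ 2) * (p * invert p) := by
    rw [map_mul, invert_C, map_pow]; ring
  rw [entropyGap, h1, h2, shannon_C_mul, shannon_C_mul, entropyGap, map_mul, map_mul, mass_invert]
  push_cast
  ring

/-! ### Additivity of the gap by separation of scales -/

lemma exists_shannon_mul_dilate (s : Finset ℤ) : ∃ L : ℤ,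
    ∀ x y : ℝ≥0[T;T⁻¹], x.coeff.support ⊆ s →
      shannon (x * dilate L y) = mass y * shannon x + mass x * shannon y := by
  obtain ⟨B, hB⟩ : ∃ B : ℤ, ∀ i ∈ s, |i| ≤ B := by
    obtain ⟨B, hB⟩ := (s.image (fun i : ℤ => |i|)).exists_le
    exact ⟨B, fun i hi => hB _ (Finset.mem_image_of_mem _ hi)⟩
  -- Differences of elements of `s` are at most `2 * |B|` in absolute value, so none but zero is a
  -- multiple of this `L`; hence `i + L * j` determines `i` and `j`.
  refine ⟨2 * |B| + 1, fun x y hx => ?_⟩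
  rw [shannon_mul, mass_dilate, shannon_dilate (by positivity)]
  intro i hi j hj k l hk hl e
  obtain ⟨j', rfl⟩ := support_dilate _ _ hj
  obtain ⟨l', rfl⟩ := support_dilate _ _ hl
  have h1 := abs_le.1 (hB i (hx hi))
  have h2 := abs_le.1 (hB k (hx hk))
  have h3 := le_abs_self B
  have : j' = l' := by
    by_contra hne
    have hd : (2 * |B| + 1) ∣ k - i := ⟨j' - l', by linarith⟩
    have h0 : k - i = 0 := Int.eq_zero_of_abs_lt_dvd hd (by rw [abs_lt]; constructor <;> linarith)
    have : (2 * |B| + 1) * (j' - l') = 0 := by linarith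
    rcases mul_eq_zero.1 this with h | h
    · have := abs_nonneg B; omega
    · omega
  subst this
  exact ⟨by linarith, rfl⟩

/-- Gaps of two finitely supported laws can be added. -/
lemma exists_entropyGap_add {p q : ℝ≥0[T;T⁻¹]} (hp : mass p = 1) (hq : mass q = 1) :
    ∃ r, mass r = 1 ∧ entropyGap r = entropyGap p + entropyGap q := by
  obtain ⟨L, hL⟩ := exists_shannon_mul_dilate
    ((p * p).coeff.support ∪ (p * invert p).coeff.support)
  -- The law of `K + L * K'` with `K`, `K'` independent of laws `p`, `q`. One `L` serves both the
  -- sum and the difference.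
  refine ⟨p * dilate L q, by rw [map_mul, mass_dilate, hp, hq, one_mul], ?_⟩
  have h1 : p * dilate L q * (p * dilate L q) = p * p * dilate L (q * q) := by
    rw [map_mul]; ring
  have h2 : p * dilate L q * invert (p * dilate L q) = p * invert p * dilate L (q * invert q) := by
    rw [map_mul, map_mul, invert_dilate]; ring
  rw [entropyGap, h1, h2, hL _ _ Finset.subset_union_left, hL _ _ Finset.subset_union_right]
  simp only [map_mul, mass_invert, hp, hq, entropyGap]
  push_cast
  ring

lemma exists_entropyGap_nsmul {p : ℝ≥0[T;T⁻¹]} (hp : mass p = 1) (n : ℕ) :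
    ∃ r, mass r = 1 ∧ entropyGap r = n * entropyGap p := by
  induction n with
  | zero => exact ⟨1, map_one _, by simp [entropyGap]⟩
  | succ n ih =>
    obtain ⟨r, hr, e⟩ := ih
    obtain ⟨r', hr', e'⟩ := exists_entropyGap_add hr hp
    exact ⟨r', hr', by rw [e', e]; push_cast; ring⟩

/-! ### Continuity of the gap along mixtures -/

lemma continuous_shannon_combination (x y z : ℝ≥0[T;T⁻¹]) {a b c : ℝ → ℝ≥0} (ha : Continuous a)
    (hb : Continuous b) (hc : Continuous c) :
    Continuous fun t => shannon (C (a t) * x + C (b t) * y + C (c t) * z) := by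
  have key : ∀ t, shannon (C (a t) * x + C (b t) * y + C (c t) * z) =
      ∑ k ∈ x.coeff.support ∪ y.coeff.support ∪ z.coeff.support,
        Real.negMulLog (a t * x.coeff k + b t * y.coeff k + c t * z.coeff k : ℝ≥0) := by
    intro t
    rw [shannon_eq_sum (s := x.coeff.support ∪ y.coeff.support ∪ z.coeff.support)]
    · simp [← smul_eq_C_mul]
    · intro k hk
      contrapose! hk
      simp only [Finset.mem_union, Finsupp.mem_support_iff, not_or, not_not] at hk
      simp [← smul_eq_C_mul, hk]
  simp_rw [key]
  refine continuous_finsetSum _ fun k _ => Real.continuous_negMulLog.comp ?_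
  fun_prop

/-- Intermediate values of the gap are attained. -/
lemma exists_entropyGap_eq {p q : ℝ≥0[T;T⁻¹]} (hp : mass p = 1) (hq : mass q = 1) {M : ℝ}
    (hqM : entropyGap q ≤ M) (hpM : M ≤ entropyGap p) : ∃ r, mass r = 1 ∧ entropyGap r = M := by
  -- Mixture of `q` and `p`; the truncation by `toNNReal` is inactive on `[0, 1]`.
  set γ : ℝ → ℝ≥0[T;T⁻¹] := fun t => C (1 - t).toNNReal * q + C t.toNNReal * p with hγ
  have hcont : Continuous fun t => entropyGap (γ t) := by
    have h1 : ∀ t, γ t * γ t = C ((1 - t).toNNReal ^ 2) * (q * q) +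
        C ((1 - t).toNNReal * t.toNNReal) * (2 * (q * p)) + C (t.toNNReal ^ 2) * (p * p) := by
      intro t; simp only [hγ, map_pow, map_mul]; ring
    have h2 : ∀ t, γ t * invert (γ t) = C ((1 - t).toNNReal ^ 2) * (q * invert q) +
        C ((1 - t).toNNReal * t.toNNReal) * (q * invert p + p * invert q) +
        C (t.toNNReal ^ 2) * (p * invert p) := by
      intro t; simp only [hγ, map_pow, map_mul, map_add, invert_C]; ring
    simp_rw [entropyGap, h1, h2]
    have hT : Continuous fun t : ℝ => t.toNNReal := continuous_real_toNNReal
    have hS : Continuous fun t : ℝ => (1 - t).toNNReal := hT.comp (by fun_prop)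
    exact (continuous_shannon_combination _ _ _ (hS.pow 2) (hS.mul hT) (hT.pow 2)).sub
      (continuous_shannon_combination _ _ _ (hS.pow 2) (hS.mul hT) (hT.pow 2))
  have h0 : γ 0 = q := by simp [hγ]
  have h1 : γ 1 = p := by simp [hγ]
  obtain ⟨t, ht, e⟩ := intermediate_value_Icc (zero_le_one' ℝ) hcont.continuousOn
    (show M ∈ Set.Icc _ _ by simp only [h0, h1]; exact ⟨hqM, hpM⟩)
  refine ⟨γ t, ?_, e⟩
  simp only [hγ, map_add, map_mul, mass_C, hp, hq, mul_one]
  rw [← Real.toNNReal_add (by linarith [ht.2]) ht.1]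
  simp

/-! ### Explicit laws with positive and negative gap -/

lemma shannon_sum_C_mul_T (n : ℕ) (c : ℕ → ℝ≥0) :
    shannon (∑ i ∈ Finset.range n, C (c i) * T 1 ^ i) =
      ∑ i ∈ Finset.range n, Real.negMulLog (c i) := by
  have hc : ∀ k : ℕ, (∑ i ∈ Finset.range n, C (c i) * T 1 ^ i : ℝ≥0[T;T⁻¹]).coeff k =
      if k < n then c k else 0 := by
    intro k
    simp [T_pow, ← smul_eq_C_mul, Finsupp.finsetSum_apply]
  rw [shannon_eq_sum (s := (Finset.range n).image (fun i : ℕ => (i : ℤ))),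
    Finset.sum_image (by simp)]
  · refine Finset.sum_congr rfl fun k hk => ?_
    rw [hc, if_pos (Finset.mem_range.1 hk)]
  · intro k hk
    by_contra h
    rw [Finsupp.mem_support_iff] at hk
    apply hk
    simp only [Finset.mem_image, Finset.mem_range, not_exists, not_and] at h
    simp only [T_pow, ← smul_eq_C_mul, AddMonoidAlgebra.coeff_sum, Finsupp.finsetSum_apply]
    refine Finset.sum_eq_zero fun i hi => ?_
    have := h i (Finset.mem_range.1 hi)
    simp [this]

/-- Translation invariance, used to move the difference law to nonnegative exponents. -/
lemma shannon_T_mul (n : ℤ) (q : ℝ≥0[T;T⁻¹]) : shannon (T n * q) = shannon q := by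
  rw [shannon_mul, mass_T, T, shannon, AddMonoidAlgebra.coeff_single,
    Finsupp.sum_single_index (by simp)]
  · simp
  intro i hi j hj k l hk hl e
  have key : ∀ m ∈ (T n : ℝ≥0[T;T⁻¹]).coeff.support, m = n := fun m hm => by
    by_contra h0
    simp [Ne.symm h0] at hm
  have := key i hi
  have := key k hk
  omega

lemma exists_entropyGap_pos : ∃ p, mass p = 1 ∧ 0 < entropyGap p := by
  set p : ℝ≥0[T;T⁻¹] := 1 + 4 * T 1 + T 1 ^ 2 + 3 * T 1 ^ 4 + 3 * T 1 ^ 5 with hp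
  have hT : (T (-1) : ℝ≥0[T;T⁻¹]) * T 1 = 1 := by rw [← T_add]; simp
  have hinv : invert p = T (-1) ^ 5 * (T 1 ^ 5 + 4 * T 1 ^ 4 + T 1 ^ 3 + 3 * T 1 + 3) := by
    have e : (T (-1) ^ 5 : ℝ≥0[T;T⁻¹]) * (T 1 ^ 5 + 4 * T 1 ^ 4 + T 1 ^ 3 + 3 * T 1 + 3) =
        (T (-1) * T 1) ^ 5 + 4 * (T (-1) * T 1) ^ 4 * T (-1)
          + (T (-1) * T 1) ^ 3 * T (-1) ^ 2
          + 3 * (T (-1) * T 1) * T (-1) ^ 4 + 3 * T (-1) ^ 5 := by ring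
    have c3 : invert (3 : ℝ≥0[T;T⁻¹]) = 3 := map_ofNat _ 3
    have c4 : invert (4 : ℝ≥0[T;T⁻¹]) = 4 := map_ofNat _ 4
    rw [e, hT, hp]
    simp [c3, c4]
  have h1 : p * p = ∑ i ∈ Finset.range 11,
      C (([1, 8, 18, 8, 7, 30, 30, 6, 9, 18, 9] : List ℝ≥0).getD i 0) * T 1 ^ i := by
    simp only [Finset.sum_range_succ, Finset.sum_range_zero, List.getD_cons_zero,
      List.getD_cons_succ, map_ofNat, map_one]
    rw [hp]; ring
  have hT5 : (T (-5) : ℝ≥0[T;T⁻¹]) = T (-1) ^ 5 := by rw [T_pow]; norm_num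
  have h2 : p * invert p = T (-5) * ∑ i ∈ Finset.range 11,
      C (([3, 15, 15, 4, 17, 36, 17, 4, 15, 15, 3] : List ℝ≥0).getD i 0) * T 1 ^ i := by
    simp only [Finset.sum_range_succ, Finset.sum_range_zero, List.getD_cons_zero,
      List.getD_cons_succ, map_ofNat]
    rw [hinv, hT5, hp]; ring
  have hgap : 0 < entropyGap p := by
    rw [entropyGap, h1, h2, shannon_T_mul, shannon_sum_C_mul_T, shannon_sum_C_mul_T]
    simp only [Finset.sum_range_succ, Finset.sum_range_zero, List.getD_cons_zero,
      List.getD_cons_succ, Real.negMulLog, NNReal.coe_ofNat, NNReal.coe_one, Real.log_one]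
    have l4 : Real.log 4 = 2 * Real.log 2 := by
      rw [show (4 : ℝ) = 2 ^ 2 by norm_num, Real.log_pow]; norm_num
    have l8 : Real.log 8 = 3 * Real.log 2 := by
      rw [show (8 : ℝ) = 2 ^ 3 by norm_num, Real.log_pow]; norm_num
    have l9 : Real.log 9 = 2 * Real.log 3 := by
      rw [show (9 : ℝ) = 3 ^ 2 by norm_num, Real.log_pow]; norm_num
    have l6 : Real.log 6 = Real.log 2 + Real.log 3 := by
      rw [← Real.log_mul (by norm_num) (by norm_num)]; norm_num
    have l18 : Real.log 18 = Real.log 2 + Real.log 9 := by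
      rw [← Real.log_mul (by norm_num) (by norm_num)]; norm_num
    have l36 : Real.log 36 = Real.log 2 + Real.log 18 := by
      rw [← Real.log_mul (by norm_num) (by norm_num)]; norm_num
    have l30 : Real.log 30 = Real.log 2 + Real.log 15 := by
      rw [← Real.log_mul (by norm_num) (by norm_num)]; norm_num
    -- The gap of the unnormalised `p` is exactly the right side minus the left; the `log 15` terms
    -- cancel.
    have key : 62 * Real.log 2 + 7 * Real.log 7 + 36 * Real.log 3 < 34 * Real.log 17 := by
      have e : Real.log (2 ^ 62 * 7 ^ 7 * 3 ^ 36) < Real.log (17 ^ 34) :=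
        Real.log_lt_log (by norm_num) (by norm_num)
      rw [Real.log_mul (by norm_num) (by norm_num), Real.log_mul (by norm_num) (by norm_num),
        Real.log_pow, Real.log_pow, Real.log_pow, Real.log_pow] at e
      exact_mod_cast e
    rw [l36, l30, l18, l9, l8, l6, l4]
    linarith
  refine ⟨C 12⁻¹ * p, ?_, ?_⟩
  · simp only [hp, map_mul, map_add, map_pow, mass_C, mass_T, map_ofNat, map_one]
    norm_num
  · rw [entropyGap_C_mul]
    positivity

lemma exists_entropyGap_neg : ∃ p, mass p = 1 ∧ entropyGap p < 0 := by
  -- In `{0, 1, 3}` nonzero differences are distinct: seven differences against six sums. The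
  -- unnormalised gap is `3 log 3 - 6 log 2`.
  set p : ℝ≥0[T;T⁻¹] := 1 + T 1 + T 1 ^ 3 with hp
  have hT : (T (-1) : ℝ≥0[T;T⁻¹]) * T 1 = 1 := by rw [← T_add]; simp
  have hinv : invert p = T (-1) ^ 3 * (T 1 ^ 3 + T 1 ^ 2 + 1) := by
    have e : (T (-1) ^ 3 : ℝ≥0[T;T⁻¹]) * (T 1 ^ 3 + T 1 ^ 2 + 1) =
        (T (-1) * T 1) ^ 3 + (T (-1) * T 1) ^ 2 * T (-1) + T (-1) ^ 3 := by ring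
    rw [e, hT, hp]
    simp
  have h1 : p * p = ∑ i ∈ Finset.range 7,
      C (([1, 2, 1, 2, 2, 0, 1] : List ℝ≥0).getD i 0) * T 1 ^ i := by
    simp only [Finset.sum_range_succ, Finset.sum_range_zero, List.getD_cons_zero,
      List.getD_cons_succ, map_ofNat, map_one, map_zero]
    rw [hp]; ring
  have hT3 : (T (-3) : ℝ≥0[T;T⁻¹]) = T (-1) ^ 3 := by rw [T_pow]; norm_num
  have h2 : p * invert p = T (-3) * ∑ i ∈ Finset.range 7,
      C (([1, 1, 1, 3, 1, 1, 1] : List ℝ≥0).getD i 0) * T 1 ^ i := by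
    simp only [Finset.sum_range_succ, Finset.sum_range_zero, List.getD_cons_zero,
      List.getD_cons_succ, map_ofNat, map_one]
    rw [hinv, hT3, hp]; ring
  have hgap : entropyGap p < 0 := by
    rw [entropyGap, h1, h2, shannon_T_mul, shannon_sum_C_mul_T, shannon_sum_C_mul_T]
    simp only [Finset.sum_range_succ, Finset.sum_range_zero, List.getD_cons_zero,
      List.getD_cons_succ, Real.negMulLog, NNReal.coe_ofNat, NNReal.coe_one, NNReal.coe_zero,
      Real.log_one]
    have key : 3 * Real.log 3 < 6 * Real.log 2 := by
      have e : Real.log (3 ^ 3) < Real.log (2 ^ 6) :=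
        Real.log_lt_log (by norm_num) (by norm_num)
      rw [Real.log_pow, Real.log_pow] at e
      exact_mod_cast e
    linarith
  refine ⟨C 3⁻¹ * p, ?_, ?_⟩
  · simp only [hp, map_mul, map_add, map_pow, mass_C, mass_T, map_one]
    norm_num
  · rw [entropyGap_C_mul]
    exact mul_neg_of_pos_of_neg (by positivity) hgap

/-- Every real number is the entropy gap of some finitely supported law on the integers. -/
theorem exists_entropyGap (M : ℝ) : ∃ p, mass p = 1 ∧ entropyGap p = M := by
  obtain ⟨p, hp, hp0⟩ := exists_entropyGap_pos
  obtain ⟨q, hq, hq0⟩ := exists_entropyGap_neg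
  -- Multiples of the positive and negative gaps bracket `M`.
  obtain ⟨m, hm⟩ := Archimedean.arch M hp0
  obtain ⟨n, hn⟩ := Archimedean.arch (-M) (neg_pos.2 hq0)
  obtain ⟨p', hp', ep⟩ := exists_entropyGap_nsmul hp m
  obtain ⟨q', hq', eq⟩ := exists_entropyGap_nsmul hq n
  rw [nsmul_eq_mul] at hm hn
  exact exists_entropyGap_eq hp' hq' (by linarith) (by linarith)

end LaurentPolynomial

/-! ### Lattice laws smoothed by a density -/

/-- At most one term is nonzero, and `negMulLog 0 = 0`. -/
lemma Real.negMulLog_sum_of_pairwise {ι : Type*} (s : Finset ι) (f : ι → ℝ)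
    (hf : ∀ i ∈ s, ∀ j ∈ s, i ≠ j → f i = 0 ∨ f j = 0) :
    Real.negMulLog (∑ i ∈ s, f i) = ∑ i ∈ s, Real.negMulLog (f i) := by
  by_cases h : ∃ k ∈ s, f k ≠ 0
  · obtain ⟨k, hk, hk0⟩ := h
    have h0 : ∀ j ∈ s, j ≠ k → f j = 0 := fun j hj hjk =>
      (hf k hk j hj (Ne.symm hjk)).resolve_left hk0
    rw [Finset.sum_eq_single_of_mem k hk h0,
      Finset.sum_eq_single_of_mem k hk fun j hj hjk => by rw [h0 j hj hjk, Real.negMulLog_zero]]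
  · push Not at h
    rw [Finset.sum_eq_zero h, Real.negMulLog_zero,
      Finset.sum_eq_zero fun j hj => by rw [h j hj, Real.negMulLog_zero]]

lemma map_add_left_withDensity (c : ℝ) {g : ℝ → ℝ≥0∞} (hg : Measurable g) :
    (volume.withDensity g).map (c + ·) = volume.withDensity fun x => g (x - c) := by
  ext s hs
  rw [Measure.map_apply (by fun_prop) hs, withDensity_apply _ hs,
    withDensity_apply _ (hs.preimage (by fun_prop)),
    ← (measurePreserving_add_left volume c).setLIntegral_comp_preimage hs
      (f := fun x => g (x - c)) (by fun_prop)]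
  simp

namespace LaurentPolynomial

/-- The measure with mass `p.coeff k` at the even integer `2 * k`. -/
noncomputable def latticeMeasure (p : ℝ≥0[T;T⁻¹]) : Measure ℝ :=
  p.coeff.sum fun k a => (a : ℝ≥0∞) • Measure.dirac (2 * k : ℝ)

/-- The superposition of the translates of `g` to the even integers, weighted by `p`. -/
noncomputable def superpose (g : ℝ → ℝ≥0) (p : ℝ≥0[T;T⁻¹]) (x : ℝ) : ℝ≥0 :=
  p.coeff.sum fun k a => a * g (x - 2 * k)

lemma latticeMeasure_single (n : ℤ) (a : ℝ≥0) :
    latticeMeasure (.single n a) = (a : ℝ≥0∞) • Measure.dirac (2 * n : ℝ) := by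
  rw [latticeMeasure, AddMonoidAlgebra.coeff_single, Finsupp.sum_single_index (by simp)]

lemma latticeMeasure_add (p q : ℝ≥0[T;T⁻¹]) :
    latticeMeasure (p + q) = latticeMeasure p + latticeMeasure q := by
  rw [latticeMeasure, AddMonoidAlgebra.coeff_add, Finsupp.sum_add_index' (by simp)]
  · rfl
  · intro k a b
    rw [ENNReal.coe_add, add_smul]

lemma superpose_single (g : ℝ → ℝ≥0) (n : ℤ) (a : ℝ≥0) (x : ℝ) :
    superpose g (.single n a) x = a * g (x - 2 * n) := by
  rw [superpose, AddMonoidAlgebra.coeff_single, Finsupp.sum_single_index (by simp)]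

lemma superpose_add (g : ℝ → ℝ≥0) (p q : ℝ≥0[T;T⁻¹]) (x : ℝ) :
    superpose g (p + q) x = superpose g p x + superpose g q x := by
  rw [superpose, AddMonoidAlgebra.coeff_add, Finsupp.sum_add_index' (by simp)]
  · rfl
  · intro k a b
    rw [add_mul]

lemma measurable_superpose {g : ℝ → ℝ≥0} (hg : Measurable g) (p : ℝ≥0[T;T⁻¹]) :
    Measurable (superpose g p) := by
  unfold superpose Finsupp.sum
  fun_prop

/-- Induction over Laurent polynomials from monomials and sums. -/
lemma induction_single {motive : ℝ≥0[T;T⁻¹] → Prop} (p : ℝ≥0[T;T⁻¹])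
    (add : ∀ p q, motive p → motive q → motive (p + q))
    (single : ∀ (n : ℤ) (a : ℝ≥0), motive (.single n a)) : motive p :=
  LaurentPolynomial.induction_on' p add fun n a => by
    rw [← single_eq_C_mul_T]; exact single n a

instance (p : ℝ≥0[T;T⁻¹]) : IsFiniteMeasure (latticeMeasure p) := by
  induction p using induction_single with
  | add p q hp hq => rw [latticeMeasure_add]; infer_instance
  | single n a =>
    rw [latticeMeasure_single]
    exact Measure.smul_finite _ ENNReal.coe_ne_top

lemma latticeMeasure_univ (p : ℝ≥0[T;T⁻¹]) : latticeMeasure p Set.univ = mass p := by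
  induction p using induction_single with
  | add p q hp hq => rw [latticeMeasure_add, Measure.add_apply, hp, hq, map_add, ENNReal.coe_add]
  | single n a => rw [latticeMeasure_single, mass_single]; simp

lemma latticeMeasure_mul (p q : ℝ≥0[T;T⁻¹]) :
    latticeMeasure (p * q) = latticeMeasure p ∗ latticeMeasure q := by
  induction p using induction_single with
  | add p p' hp hp' =>
    rw [add_mul, latticeMeasure_add, latticeMeasure_add, Measure.add_conv, hp, hp']
  | single n a =>
    induction q using induction_single with
    | add q q' hq hq' =>
      rw [mul_add, latticeMeasure_add, latticeMeasure_add, Measure.conv_add, hq, hq']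
    | single m b =>
      rw [AddMonoidAlgebra.single_mul_single, latticeMeasure_single, latticeMeasure_single,
        latticeMeasure_single, Measure.conv_smul_left, Measure.conv_smul_right,
        Measure.dirac_conv_dirac, smul_smul]
      push_cast
      rw [mul_add]

lemma latticeMeasure_invert (p : ℝ≥0[T;T⁻¹]) :
    latticeMeasure (invert p) = (latticeMeasure p).map Neg.neg := by
  induction p using induction_single with
  | add p q hp hq =>
    rw [map_add, latticeMeasure_add, latticeMeasure_add, Measure.map_add _ _ measurable_neg, hp, hq]
  | single n a =>
    rw [invert_single, latticeMeasure_single, latticeMeasure_single, Measure.map_smul,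
      Measure.map_dirac' measurable_neg]
    push_cast
    rw [mul_neg]

lemma latticeMeasure_conv_withDensity {g : ℝ → ℝ≥0} (hg : Measurable g) (p : ℝ≥0[T;T⁻¹]) :
    latticeMeasure p ∗ volume.withDensity (fun x => (g x : ℝ≥0∞)) =
      volume.withDensity fun x => (superpose g p x : ℝ≥0∞) := by
  induction p using induction_single with
  | add p q hp hq =>
    rw [latticeMeasure_add, Measure.add_conv, hp, hq, ← withDensity_add_left
      (measurable_superpose hg p).coe_nnreal_ennreal]
    congr 1
    ext x
    rw [superpose_add, ENNReal.coe_add, Pi.add_apply]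
  | single n a =>
    rw [latticeMeasure_single, Measure.conv_smul_left, Measure.dirac_conv,
      map_add_left_withDensity _ hg.coe_nnreal_ennreal,
      ← withDensity_smul _ (by fun_prop)]
    congr 1
    ext x
    rw [superpose_single, ENNReal.coe_mul, Pi.smul_apply, smul_eq_mul]

/-! ### Entropy of a superposition of disjoint bumps -/

section Entropy

variable {g : ℝ → ℝ≥0} (hg : Measurable g) (hg1 : ∀ x, g x ≤ 1)
  (hgs : ∀ x, x ∉ Set.Ioo (-1 : ℝ) 1 → g x = 0)

include hg hgs in
lemma integrable_comp_of_support {φ : ℝ → ℝ} (hφ : Measurable φ) (hφ0 : φ 0 = 0)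
    (hφ1 : ∀ x, |φ (g x)| ≤ 1) : Integrable fun x => φ (g x) := by
  have hI : Integrable ((Set.Ioo (-1 : ℝ) 1).indicator fun _ => (1 : ℝ)) :=
    (integrable_indicator_iff measurableSet_Ioo).2 (integrableOn_const (by simp))
  refine hI.mono' (hφ.comp hg.coe_nnreal_real).aestronglyMeasurable (Filter.Eventually.of_forall fun x => ?_)
  by_cases hx : x ∈ Set.Ioo (-1 : ℝ) 1
  · rw [Set.indicator_of_mem hx]; exact hφ1 x
  · rw [hgs x hx]; simp [hφ0, hx]

include hg hg1 hgs in
lemma integrable_of_support : Integrable fun x => (g x : ℝ) :=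
  integrable_comp_of_support hg hgs measurable_id rfl fun x => by
    rw [id, abs_of_nonneg (g x).coe_nonneg]; exact_mod_cast hg1 x

include hg hg1 hgs in
lemma integrable_negMulLog_of_support : Integrable fun x => Real.negMulLog (g x) :=
  integrable_comp_of_support hg hgs Real.continuous_negMulLog.measurable Real.negMulLog_zero
    fun x => by
      have h1 : (g x : ℝ) ≤ 1 := by exact_mod_cast hg1 x
      have h0 : (0 : ℝ) ≤ g x := (g x).coe_nonneg
      rw [abs_of_nonneg (Real.negMulLog_nonneg h0 h1)]
      linarith [Real.negMulLog_le_one_sub_self h0]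

include hgs in
lemma negMulLog_superpose (p : ℝ≥0[T;T⁻¹]) (x : ℝ) :
    Real.negMulLog (superpose g p x) = ∑ k ∈ p.coeff.support,
      (Real.negMulLog (p.coeff k) * g (x - 2 * k) + p.coeff k * Real.negMulLog (g (x - 2 * k))) := by
  rw [superpose, Finsupp.sum]
  push_cast
  rw [Real.negMulLog_sum_of_pairwise]
  · exact Finset.sum_congr rfl fun k _ => by rw [Real.negMulLog_mul]; ring
  · intro i _ j _ hij
    by_contra! h
    have hmem : ∀ k : ℤ, (p.coeff k * g (x - 2 * k) : ℝ) ≠ 0 → x - 2 * k ∈ Set.Ioo (-1 : ℝ) 1 := by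
      intro k hk
      by_contra hx
      rw [hgs _ hx] at hk
      simp at hk
    obtain ⟨hi1, hi2⟩ := hmem i h.1
    obtain ⟨hj1, hj2⟩ := hmem j h.2
    -- Two centres `2 * i`, `2 * j` within distance one of `x` differ by less than two, so `i = j`.
    have h1 : (i : ℝ) < j + 1 := by linarith
    have h2 : (j : ℝ) < i + 1 := by linarith
    norm_cast at h1 h2
    omega

include hg hg1 hgs in
lemma integrable_negMulLog_superpose (p : ℝ≥0[T;T⁻¹]) :
    Integrable fun x => Real.negMulLog (superpose g p x) := by
  simp_rw [negMulLog_superpose hgs]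
  exact integrable_finsetSum _ fun k _ =>
    (((integrable_of_support hg hg1 hgs).comp_sub_right _).const_mul _).add
      (((integrable_negMulLog_of_support hg hg1 hgs).comp_sub_right _).const_mul _)

include hg hg1 hgs in
lemma integral_negMulLog_superpose (p : ℝ≥0[T;T⁻¹]) :
    ∫ x, Real.negMulLog (superpose g p x) =
      shannon p * (∫ x, (g x : ℝ)) + mass p * ∫ x, Real.negMulLog (g x) := by
  have I1 : ∀ k : ℤ, Integrable fun x => Real.negMulLog (p.coeff k) * (g (x - 2 * k) : ℝ) :=
    fun k => ((integrable_of_support hg hg1 hgs).comp_sub_right _).const_mul _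
  have I2 : ∀ k : ℤ, Integrable fun x => (p.coeff k : ℝ) * Real.negMulLog (g (x - 2 * k)) :=
    fun k => ((integrable_negMulLog_of_support hg hg1 hgs).comp_sub_right _).const_mul _
  simp_rw [negMulLog_superpose hgs]
  rw [integral_finsetSum _ fun k _ => by exact (I1 k).add (I2 k), shannon, mass_eq_sum, Finsupp.sum,
    Finsupp.sum]
  push_cast
  rw [Finset.sum_mul, Finset.sum_mul, ← Finset.sum_add_distrib]
  refine Finset.sum_congr rfl fun k _ => ?_
  rw [integral_add (I1 k) (I2 k), integral_const_mul, integral_const_mul,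
    integral_sub_right_eq_self (fun x => (g x : ℝ)),
    integral_sub_right_eq_self (fun x => Real.negMulLog (g x))]

end Entropy

end LaurentPolynomial

/-! ### From laws to differential entropy -/

lemma realDensity_ae_eq {Ω : Type*} [MeasurableSpace Ω] {P : Measure Ω} {X : Ω → ℝ}
    [HasPDF X P volume] {f : ℝ → ℝ≥0} (hf : Measurable f)
    (h : P.map X = volume.withDensity fun x => (f x : ℝ≥0∞)) :
    realDensity P X =ᵐ[volume] fun x => (f x : ℝ) := by
  filter_upwards [(pdf.eq_of_map_eq_withDensity' _ hf.coe_nnreal_ennreal.aemeasurable).1 h]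
    with x hx
  rw [realDensity, hx, ENNReal.coe_toReal]

lemma hasFiniteDifferentialEntropy_of_map_eq {Ω : Type*} [MeasurableSpace Ω] {P : Measure Ω}
    {X : Ω → ℝ} (hX : Measurable X) {f : ℝ → ℝ≥0} (hf : Measurable f)
    (h : P.map X = volume.withDensity fun x => (f x : ℝ≥0∞))
    (hint : Integrable fun x => Real.negMulLog (f x)) : HasFiniteDifferentialEntropy P X := by
  have hpdf : HasPDF X P volume :=
    hasPDF_of_map_eq_withDensity hX.aemeasurable _ hf.coe_nnreal_ennreal.aemeasurable h
  refine ⟨hpdf, hint.neg.congr ?_⟩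
  filter_upwards [realDensity_ae_eq hf h] with x hx
  rw [hx, Pi.neg_apply, Real.negMulLog, neg_mul, neg_neg]

lemma differentialEntropy_of_map_eq {Ω : Type*} [MeasurableSpace Ω] {P : Measure Ω}
    {X : Ω → ℝ} (hX : Measurable X) {f : ℝ → ℝ≥0} (hf : Measurable f)
    (h : P.map X = volume.withDensity fun x => (f x : ℝ≥0∞)) :
    differentialEntropy P X = ∫ x, Real.negMulLog (f x) := by
  have hpdf : HasPDF X P volume :=
    hasPDF_of_map_eq_withDensity hX.aemeasurable _ hf.coe_nnreal_ennreal.aemeasurable h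
  rw [differentialEntropy, ← integral_neg]
  refine integral_congr_ae ?_
  filter_upwards [realDensity_ae_eq hf h] with x hx
  rw [hx, Real.negMulLog, neg_mul]

/-! ### Box and tent densities -/

/-- The density of the uniform distribution on `(-1/2, 1/2)`. -/
noncomputable def boxDensity : ℝ → ℝ≥0 := (Set.Ioo (-1 / 2 : ℝ) (1 / 2)).indicator 1

/-- The uniform distribution on `(-1/2, 1/2)`. -/
noncomputable def boxMeasure : Measure ℝ := volume.withDensity fun x => (boxDensity x : ℝ≥0∞)

/-- The density of the sum of two independent uniform variables on `(-1/2, 1/2)`. -/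
noncomputable def tentDensity (x : ℝ) : ℝ≥0 :=
  (((fun x => (boxDensity x : ℝ≥0∞)) ⋆ₗ fun x => (boxDensity x : ℝ≥0∞)) x).toNNReal

lemma measurable_boxDensity : Measurable boxDensity :=
  measurable_one.indicator measurableSet_Ioo

lemma boxDensity_le_one (x : ℝ) : boxDensity x ≤ 1 :=
  Set.indicator_le_self' (fun _ _ => zero_le_one) x

lemma boxDensity_eq_zero {x : ℝ} (hx : x ∉ Set.Ioo (-1 / 2 : ℝ) (1 / 2)) : boxDensity x = 0 :=
  Set.indicator_of_notMem hx _

lemma boxDensity_neg (x : ℝ) : boxDensity (-x) = boxDensity x := by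
  have : -x ∈ Set.Ioo (-1 / 2 : ℝ) (1 / 2) ↔ x ∈ Set.Ioo (-1 / 2 : ℝ) (1 / 2) := by
    simp only [Set.mem_Ioo]; constructor <;> rintro ⟨h1, h2⟩ <;> constructor <;> linarith
  by_cases hx : x ∈ Set.Ioo (-1 / 2 : ℝ) (1 / 2)
  · rw [boxDensity, Set.indicator_of_mem hx, Set.indicator_of_mem (this.2 hx)]; rfl
  · rw [boxDensity_eq_zero hx, boxDensity_eq_zero (mt this.1 hx)]

lemma lintegral_boxDensity : ∫⁻ x, (boxDensity x : ℝ≥0∞) = 1 := by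
  have : (fun x => (boxDensity x : ℝ≥0∞)) = (Set.Ioo (-1 / 2 : ℝ) (1 / 2)).indicator 1 := by
    ext x
    by_cases hx : x ∈ Set.Ioo (-1 / 2 : ℝ) (1 / 2) 
    · rw [boxDensity, Set.indicator_of_mem hx, Set.indicator_of_mem hx]; rfl
    · rw [boxDensity_eq_zero hx, Set.indicator_of_notMem hx]; rfl
  rw [this, lintegral_indicator_one measurableSet_Ioo, Real.volume_Ioo]
  norm_num

instance : IsProbabilityMeasure boxMeasure :=
  ⟨by rw [boxMeasure, withDensity_apply _ MeasurableSet.univ, setLIntegral_univ,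
    lintegral_boxDensity]⟩

lemma map_neg_boxMeasure : boxMeasure.map Neg.neg = boxMeasure := by
  ext s hs
  rw [boxMeasure, Measure.map_apply measurable_neg hs, withDensity_apply _ hs,
    withDensity_apply _ (hs.preimage measurable_neg),
    ← (Measure.measurePreserving_neg (volume : Measure ℝ)).setLIntegral_comp_preimage hs
      measurable_boxDensity.coe_nnreal_ennreal]
  simp_rw [boxDensity_neg]

/-- The box is at most one with integral one, so the convolution is at most one; finiteness makes
`toNNReal` lossless. Only this bound, the support and the total mass of the tent are needed, never a
formula. -/
lemma coe_tentDensity (x : ℝ) : (tentDensity x : ℝ≥0∞) =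
    ((fun x => (boxDensity x : ℝ≥0∞)) ⋆ₗ fun x => (boxDensity x : ℝ≥0∞)) x ∧ tentDensity x ≤ 1 := by
  have h : ((fun x => (boxDensity x : ℝ≥0∞)) ⋆ₗ fun x => (boxDensity x : ℝ≥0∞)) x ≤ 1 := by
    rw [lconvolution_def, ← lintegral_boxDensity]
    refine lintegral_mono fun y => ?_
    calc (boxDensity y : ℝ≥0∞) * boxDensity (-y + x) ≤ boxDensity y * 1 := by
          gcongr; exact_mod_cast boxDensity_le_one _
      _ = boxDensity y := mul_one _
  have e := ENNReal.coe_toNNReal (ne_top_of_le_ne_top ENNReal.one_ne_top h)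
  refine ⟨e, ?_⟩
  rw [← e] at h
  exact_mod_cast h

lemma measurable_tentDensity : Measurable tentDensity :=
  (measurable_lconvolution volume measurable_boxDensity.coe_nnreal_ennreal
    measurable_boxDensity.coe_nnreal_ennreal).ennreal_toNNReal

lemma tentDensity_le_one (x : ℝ) : tentDensity x ≤ 1 := (coe_tentDensity x).2

lemma tentDensity_eq_zero (x : ℝ) (hx : x ∉ Set.Ioo (-1 : ℝ) 1) : tentDensity x = 0 := by
  rw [← ENNReal.coe_eq_zero, (coe_tentDensity x).1, lconvolution_def]
  refine (lintegral_congr fun y => ?_).trans lintegral_zero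
  by_cases hy : y ∈ Set.Ioo (-1 / 2 : ℝ) (1 / 2)
  · rw [boxDensity_eq_zero (x := -y + x), ENNReal.coe_zero, mul_zero]
    intro h
    exact hx ⟨by linarith [hy.1, h.1], by linarith [hy.2, h.2]⟩
  · rw [boxDensity_eq_zero hy, ENNReal.coe_zero, zero_mul]

lemma boxMeasure_conv_self :
    boxMeasure ∗ boxMeasure = volume.withDensity fun x => (tentDensity x : ℝ≥0∞) := by
  rw [boxMeasure, conv_withDensity_eq_lconvolution measurable_boxDensity.coe_nnreal_ennreal
    measurable_boxDensity.coe_nnreal_ennreal]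
  congr 1
  ext x
  exact (coe_tentDensity x).1.symm

lemma integral_tentDensity : ∫ x, (tentDensity x : ℝ) = 1 := by
  have h : ∫⁻ x, (tentDensity x : ℝ≥0∞) = 1 := by
    rw [← setLIntegral_univ, ← withDensity_apply _ MeasurableSet.univ, ← boxMeasure_conv_self]
    exact measure_univ
  rw [integral_eq_lintegral_of_nonneg_ae (Filter.Eventually.of_forall fun x => NNReal.coe_nonneg _)
    measurable_tentDensity.coe_nnreal_real.aestronglyMeasurable]
  simp [h]

/-! ### Assembly -/

lemma map_sub_prod_eq_conv (μ ν : Measure ℝ) [SFinite μ] [SFinite ν] :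
    (μ.prod ν).map (fun z => z.1 - z.2) = μ ∗ ν.map Neg.neg := by
  have h := Measure.map_prod_map μ ν measurable_id measurable_neg
  rw [Measure.map_id] at h
  rw [Measure.conv, h, Measure.map_map (by fun_prop) (by fun_prop)]
  simp [Function.comp_def, sub_eq_add_neg]

theorem mainTheorem4 (M : ℝ) :
    ∃ (Ω : Type) (_ : MeasurableSpace Ω) (P : Measure Ω) (_ : IsProbabilityMeasure P)
      (X Y : Ω → ℝ),
      Measurable X ∧ Measurable Y ∧ IndepFun X Y P ∧ IdentDistrib X Y P P ∧
      HasFiniteDifferentialEntropy P X ∧ HasFiniteDifferentialEntropy P Y ∧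
      HasFiniteDifferentialEntropy P (fun ω => X ω + Y ω) ∧
      HasFiniteDifferentialEntropy P (fun ω => X ω - Y ω) ∧
      differentialEntropy P (fun ω => X ω + Y ω) -
        differentialEntropy P (fun ω => X ω - Y ω) = M := by
  obtain ⟨p, hp, hM⟩ := exists_entropyGap M
  have : IsProbabilityMeasure (latticeMeasure p) := ⟨by rw [latticeMeasure_univ, hp]; rfl⟩
  set μ : Measure ℝ := latticeMeasure p ∗ boxMeasure with hμ
  -- Commutativity regroups the two lattice parts and the two boxes. Taking `q = p` gives the sum,
  -- `q = invert p` the difference.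
  have hconv : ∀ q : ℝ≥0[T;T⁻¹], μ ∗ (latticeMeasure q ∗ boxMeasure) =
      volume.withDensity fun x => (superpose tentDensity (p * q) x : ℝ≥0∞) := by
    intro q
    rw [← latticeMeasure_conv_withDensity measurable_tentDensity, ← boxMeasure_conv_self,
      latticeMeasure_mul, hμ, Measure.conv_assoc, ← Measure.conv_assoc boxMeasure,
      Measure.conv_comm boxMeasure, Measure.conv_assoc, ← Measure.conv_assoc (latticeMeasure p)]
  have hneg : μ.map Neg.neg = latticeMeasure (invert p) ∗ boxMeasure := by
    have h : μ.map Neg.neg = (latticeMeasure p).map Neg.neg ∗ boxMeasure.map Neg.neg :=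
      Measure.map_conv_addMonoidHom (negAddMonoidHom : ℝ →+ ℝ) measurable_neg
    rw [h, map_neg_boxMeasure, latticeMeasure_invert]
  have hfst : (μ.prod μ).map Prod.fst = μ := by simp
  have hsnd : (μ.prod μ).map Prod.snd = μ := by simp
  have hadd : (μ.prod μ).map (fun z => z.1 + z.2) =
      volume.withDensity fun x => (superpose tentDensity (p * p) x : ℝ≥0∞) := hconv p
  have hsub : (μ.prod μ).map (fun z => z.1 - z.2) =
      volume.withDensity fun x => (superpose tentDensity (p * invert p) x : ℝ≥0∞) := by
    rw [map_sub_prod_eq_conv, hneg, hconv]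
  have hbox : μ = volume.withDensity fun x => (superpose boxDensity p x : ℝ≥0∞) :=
    latticeMeasure_conv_withDensity measurable_boxDensity p
  have hbox0 : ∀ x, x ∉ Set.Ioo (-1 : ℝ) 1 → boxDensity x = 0 := fun x hx =>
    boxDensity_eq_zero fun h => hx ⟨by linarith [h.1], by linarith [h.2]⟩
  have mbox := measurable_superpose measurable_boxDensity p
  have mtent := measurable_superpose measurable_tentDensity
  have ibox := integrable_negMulLog_superpose measurable_boxDensity boxDensity_le_one hbox0 p
  have itent := integrable_negMulLog_superpose measurable_tentDensity tentDensity_le_one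
    tentDensity_eq_zero
  refine ⟨ℝ × ℝ, inferInstance, μ.prod μ, inferInstance, Prod.fst, Prod.snd, measurable_fst,
    measurable_snd, indepFun_prod measurable_id measurable_id,
    ⟨measurable_fst.aemeasurable, measurable_snd.aemeasurable, hfst.trans hsnd.symm⟩,
    hasFiniteDifferentialEntropy_of_map_eq measurable_fst mbox (hfst.trans hbox) ibox,
    hasFiniteDifferentialEntropy_of_map_eq measurable_snd mbox (hsnd.trans hbox) ibox,
    hasFiniteDifferentialEntropy_of_map_eq (by fun_prop) (mtent _) hadd (itent _),
    hasFiniteDifferentialEntropy_of_map_eq (by fun_prop) (mtent _) hsub (itent _), ?_⟩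
  rw [differentialEntropy_of_map_eq (by fun_prop) (mtent _) hadd,
    differentialEntropy_of_map_eq (by fun_prop) (mtent _) hsub,
    integral_negMulLog_superpose measurable_tentDensity tentDensity_le_one tentDensity_eq_zero,
    integral_negMulLog_superpose measurable_tentDensity tentDensity_le_one tentDensity_eq_zero,
    integral_tentDensity, map_mul, map_mul, mass_invert, ← hM, entropyGap]
  ring
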